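/- Let $\mathbb D$ be the open unit disk. Let $S_H^O$ be the class of complex-valued harmonic, sense-preserving (i.e. with positive Jacobian), univalent functions $f$ in $\mathbb D$ with $f(0)=0$, $f_z(0)=1$, $f_{\bar z}(0)=0$, and let $K_H^O$ be the class of those $f\in S_H^O$ for which $f(\mathbb D)$ is convex. For harmonic functions $f=h+\overline g$ and $F=H+\overline G$ in $\mathbb D$, where $h=\sum_{k\ge1} a_kz^k$, $g=\sum_{k\ge1} b_kz^k$, $H=\sum_{k\ge1} A_kz^k$, $G=\sum_{k\ge1} B_kz^k$ are analytic in $\mathbb D$, let $$(f*F)(z)=\sum_{k\ge1}a_kA_kz^k+\overline{\sum_{k\ge1}b_kB_kz^k}.$$ Let $f_0=h_0+\overline{g_0}$ with $$h_0(z)=\frac{z-\frac12z^2}{(1-z)^2},\qquad g_0(z)=-\frac{\frac12z^2}{(1-z)^2}.$$ **Theorem.** Let $f=h+\overline g\in K_H^O$, with $h,g$ analytic in $\mathbb D$ and $h(0)=g(0)=0$, satisfy $h(z)+g(z)=\frac{z}{1-z}$ in $\mathbb D$ and have dilatation $\omega(z)=g'(z)/h'(z)=e^{i\theta}z^n$ in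 $\mathbb D$, where $\theta\in\mathbb R$ and $n$ is a positive integer. If $n=1$ or $n=2$, then $f_0*f\in S_H^O$ and $f_0*f$ is convex in the direction of the real axis, i.e. the intersection of $(f_0*f)(\mathbb D)$ with every horizontal line is connected or empty. -/

import Mathlib

open scoped ComplexConjugate

noncomputable section

namespace HarmonicMapping

/-- The open unit disk. -/
abbrev disk : Set ℂ := Metric.ball (0 : ℂ) 1

/-- The Wirtinger derivative `∂f/∂z = (f_x - i f_y) / 2`. -/
def dz (f : ℂ → ℂ) (z : ℂ) : ℂ :=
  (fderiv ℝ f z 1 - Complex.I * fderiv ℝ f z Complex.I) / 2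

/-- The Wirtinger derivative `∂f/∂z̄ = (f_x + i f_y) / 2`. -/
def dzbar (f : ℂ → ℂ) (z : ℂ) : ℂ :=
  (fderiv ℝ f z 1 + Complex.I * fderiv ℝ f z Complex.I) / 2

/-- The class `S_H^O` of complex-valued harmonic, sense-preserving, univalent functions in the
disk, normalized by `f(0) = 0`, `f_z(0) = 1`, `f_z̄(0) = 0`. -/
structure IsSHO (f : ℂ → ℂ) : Prop where
  harmonic : InnerProductSpace.HarmonicOnNhd f disk
  /-- The Jacobian, i.e. the determinant of the real differential, is positive. -/
  sense_preserving : ∀ z ∈ disk, 0 < (fderiv ℝ f z).det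
  univalent : Set.InjOn f disk
  map_zero : f 0 = 0
  dz_zero : dz f 0 = 1
  dzbar_zero : dzbar f 0 = 0

/-- The class `K_H^O` of functions in `S_H^O` that map the disk onto a convex domain. -/
structure IsKHO (f : ℂ → ℂ) : Prop extends IsSHO f where
  convex_image : Convex ℝ (f '' disk)

/-- `f = h + conj g` in the disk, with `h` and `g` analytic there and vanishing at `0`. -/
structure IsDecomposition (f h g : ℂ → ℂ) : Prop where
  analytic_h : AnalyticOnNhd ℂ h disk
  analytic_g : AnalyticOnNhd ℂ g disk
  h_zero : h 0 = 0
  g_zero : g 0 = 0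
  eq : ∀ z ∈ disk, f z = h z + conj (g z)

/-- The dilatation `ω = g' / h'` of `f = h + conj g`. -/
def dilatation (h g : ℂ → ℂ) (z : ℂ) : ℂ := deriv g z / deriv h z

/-- The `n`-th Taylor coefficient at the origin. -/
def coeff (F : ℂ → ℂ) (n : ℕ) : ℂ := iteratedDeriv n F 0 / (n.factorial : ℂ)

/-- The convolution (Hadamard product) of two functions analytic in the disk. -/
def hadamard (F G : ℂ → ℂ) (z : ℂ) : ℂ := ∑' n : ℕ, coeff F n * coeff G n * z ^ n

/-- The harmonic convolution `h * H + conj (g * G)` of `h + conj g` and `H + conj G`. -/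
def harmonicConv (h g H G : ℂ → ℂ) (z : ℂ) : ℂ := hadamard h H z + conj (hadamard g G z)

/-- The analytic part of the canonical right half-plane mapping `f₀ = h₀ + conj g₀`. -/
def h₀ (z : ℂ) : ℂ := (z - z ^ 2 / 2) / (1 - z) ^ 2

/-- The co-analytic part of the canonical right half-plane mapping `f₀ = h₀ + conj g₀`. -/
def g₀ (z : ℂ) : ℂ := -(z ^ 2 / 2) / (1 - z) ^ 2

/-- A set is convex in the direction of the real axis if it contains every horizontal segment
whose endpoints it contains. -/
def ConvexInRealDirection (S : Set ℂ) : Prop :=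
  ∀ a ∈ S, ∀ b ∈ S, a.im = b.im → segment ℝ a b ⊆ S

end HarmonicMapping

end

namespace HarmonicMapping

open Set Filter Topology

/-! The coefficients of `h₀` and `g₀` are `(1 ± k) / 2` for `k ≥ 1`, so convolving with `f₀` gives
`H + conj G` with `H = (h + z h') / 2` and `G = (g - z g') / 2`. The equation `h + g = z / (1 - z)`
and the dilatation `ω` determine `h'` and `g'`, hence also `H'` and `G'`.

Two facts about these derivatives suffice. In `(1 - z)² (H' - G')` the terms with `ω'` cancel,
leaving the mean of `(1 - ω) / (1 + ω)` and `(1 + z) / (1 - z)`, both of positive real part. The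
Jacobian condition `|G'| < |H'|` is where `n = 1` or `n = 2` enters (`norm_lt_norm_of_dilatation`).

In the coordinate `w = z / (1 - z)`, which ranges over `Re w > -1/2`, the first fact says that the
imaginary part of the map increases along every vertical line, at a rate bounded below on that line.
Its level sets are therefore graphs over the `x`-axis, and the Jacobian makes the real part increase
along them. Univalence and convexity in the real direction follow together. -/

/-! ### Level curves and horizontal slices of a planar map. -/

/-- The level curves of the second coordinate `V` of an orientation preserving local
diffeomorphism of a vertical half-plane, when `V` maps each vertical line increasingly
onto `ℝ`: they are graphs along which the first coordinate `U` increases. -/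
theorem exists_level_curve {a : ℝ} {U V : ℝ × ℝ → ℝ} {U' V' : ℝ × ℝ → ℝ × ℝ →L[ℝ] ℝ}
    (hU : ∀ p : ℝ × ℝ, a < p.1 → HasStrictFDerivAt U (U' p) p)
    (hV : ∀ p : ℝ × ℝ, a < p.1 → HasStrictFDerivAt V (V' p) p)
    (hpos : ∀ p : ℝ × ℝ, a < p.1 → 0 < V' p (0, 1))
    (hjac : ∀ p : ℝ × ℝ, a < p.1 →
      0 < U' p (1, 0) * V' p (0, 1) - U' p (0, 1) * V' p (1, 0))
    (hsurj : ∀ x, a < x → ∀ c, ∃ y, V (x, y) = c) (c : ℝ) :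
    ∃ Y : ℝ → ℝ, (∀ x, a < x → ∀ y, V (x, y) = c ↔ y = Y x) ∧
      ContinuousOn (fun x => U (x, Y x)) (Ioi a) ∧
      StrictMonoOn (fun x => U (x, Y x)) (Ioi a) := by
  have hline : ∀ x, a < x → ∀ y, HasDerivAt (fun y => V (x, y)) (V' (x, y) (0, 1)) y := by
    intro x hx y
    have h1 : HasDerivAt (fun y : ℝ => (x, y)) ((0 : ℝ), (1 : ℝ)) y :=
      (hasDerivAt_const y x).prodMk (hasDerivAt_id y)
    exact (hV (x, y) hx).hasFDerivAt.comp_hasDerivAt y h1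
  have hmono : ∀ x, a < x → StrictMono fun y => V (x, y) := by
    intro x hx
    refine strictMono_of_deriv_pos fun y => ?_
    rw [(hline x hx y).deriv]
    exact hpos (x, y) hx
  choose! Y hY using fun x (hx : a < x) => hsurj x hx c
  have hiff : ∀ x, a < x → ∀ y, V (x, y) = c ↔ y = Y x := by
    intro x hx y
    rw [← hY x hx]
    exact (hmono x hx).injective.eq_iff
  -- Monotonicity traps `Y`: if `b < Y x`, then `V (t, b) < c` persists for `t` near `x`, which
  -- forces `b < Y t`; likewise from above.
  have hcont : ∀ x, a < x → ContinuousAt Y x := by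
    intro x hx
    have hVc : ∀ y, ContinuousAt (fun x => V (x, y)) x := fun y =>
      ContinuousAt.comp (f := fun x : ℝ => (x, y)) (g := V)
        (hV (x, y) hx).hasFDerivAt.continuousAt (by fun_prop)
    have hev : ∀ᶠ t in 𝓝 x, a < t := lt_mem_nhds hx
    rw [ContinuousAt, tendsto_order]
    constructor
    · intro b hb
      have h1 : V (x, b) < c := by rw [← hY x hx]; exact hmono x hx hb
      filter_upwards [hev, (hVc b).eventually_lt continuousAt_const h1] with t ht h2
      rw [← hY t ht] at h2
      exact (hmono t ht).lt_iff_lt.1 h2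
    · intro b hb
      have h1 : c < V (x, b) := by rw [← hY x hx]; exact hmono x hx hb
      filter_upwards [hev, continuousAt_const.eventually_lt (hVc b) h1] with t ht h2
      rw [← hY t ht] at h2
      exact (hmono t ht).lt_iff_lt.1 h2
  have hdiff : ∀ x, a < x → DifferentiableAt ℝ Y x := by
    intro x hx
    have hinv : (V' (x, Y x) ∘L .inr ℝ ℝ ℝ).IsInvertible := by
      have h0 : V' (x, Y x) (0, 1) ≠ 0 := (hpos (x, Y x) hx).ne'
      refine ⟨ContinuousLinearEquiv.unitsEquivAut ℝ (Units.mk0 _ h0), ?_⟩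
      ext
      simp
    -- The implicit function describes the level set only near `(x, Y x)`; continuity of `Y` keeps
    -- `(t, Y t)` there, so the two functions agree near `x`.
    have h1 := (hV (x, Y x) hx).eventually_apply_eq_iff_implicitFunctionOfProdDomain hinv
    have h2 := (hV (x, Y x) hx).hasStrictFDerivAt_implicitFunctionOfProdDomain hinv
    have h3 : Tendsto (fun t => (t, Y t)) (𝓝 x) (𝓝 (x, Y x)) :=
      (continuousAt_id.prodMk (hcont x hx))
    refine h2.hasFDerivAt.differentiableAt.congr_of_eventuallyEq ?_
    filter_upwards [h3.eventually h1, lt_mem_nhds hx] with t ht hat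
    exact (ht.1 (by rw [hY t hat, hY x hx])).symm
  have hderiv : ∀ x, a < x → ∃ d, 0 < d ∧ HasDerivAt (fun x => U (x, Y x)) d x := by
    intro x hx
    have h1 : HasDerivAt (fun t => (t, Y t)) ((1 : ℝ), deriv Y x) x :=
      (hasDerivAt_id x).prodMk (hdiff x hx).hasDerivAt
    have hsplit : ∀ (L : ℝ × ℝ →L[ℝ] ℝ) (m : ℝ), L (1, m) = L (1, 0) + m * L (0, 1) := by
      intro L m
      have : ((1 : ℝ), m) = (1, 0) + m • (0, 1) := by simp
      rw [this, map_add, map_smul, smul_eq_mul]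
    have hVd := (hV (x, Y x) hx).hasFDerivAt.comp_hasDerivAt x h1
    have hVc : (V ∘ fun t => (t, Y t)) =ᶠ[𝓝 x] fun _ => c := by
      filter_upwards [lt_mem_nhds hx] with t ht using hY t ht
    have hzero := hVd.unique ((hasDerivAt_const x c).congr_of_eventuallyEq hVc)
    have hUd := (hU (x, Y x) hx).hasFDerivAt.comp_hasDerivAt x h1
    refine ⟨_, ?_, hUd⟩
    rw [hsplit] at hzero ⊢
    have hp := hpos (x, Y x) hx
    have hj := hjac (x, Y x) hx
    -- Since `V_x + Y' V_y = 0` on the curve, multiplying `U_x + Y' U_y` by `V_y` gives the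
    -- Jacobian.
    refine pos_of_mul_pos_left (b := V' (x, Y x) (0, 1)) ?_ hp.le
    have : V' (x, Y x) (1, 0) = -(deriv Y x * V' (x, Y x) (0, 1)) := by linarith
    rw [this] at hj
    linarith
  refine ⟨Y, hiff, ?_, ?_⟩
  · intro x hx
    obtain ⟨d, -, hd⟩ := hderiv x hx
    exact hd.continuousAt.continuousWithinAt
  · refine strictMonoOn_of_deriv_pos (convex_Ioi a) ?_ ?_
    · intro x hx
      obtain ⟨d, -, hd⟩ := hderiv x hx
      exact hd.continuousAt.continuousWithinAt
    · intro x hx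
      rw [interior_Ioi] at hx
      obtain ⟨d, hd0, hd⟩ := hderiv x hx
      rw [hd.deriv]
      exact hd0

/-- Each horizontal slice of the image is a level curve seen through its real part: strict
monotonicity separates points, and the intermediate value theorem fills segments. -/
theorem injOn_and_convexInRealDirection_of_level_curves {F : ℂ → ℂ} {a : ℝ}
    (h : ∀ c : ℝ, ∃ Y : ℝ → ℝ, (∀ x, a < x → ∀ y, (F ⟨x, y⟩).im = c ↔ y = Y x) ∧
      ContinuousOn (fun x => (F ⟨x, Y x⟩).re) (Ioi a) ∧
      StrictMonoOn (fun x => (F ⟨x, Y x⟩).re) (Ioi a)) :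
    InjOn F {w | a < w.re} ∧ ConvexInRealDirection (F '' {w | a < w.re}) := by
  constructor
  · rintro ⟨x₁, y₁⟩ h₁ ⟨x₂, y₂⟩ h₂ heq
    simp only [mem_ofPred_eq] at h₁ h₂
    obtain ⟨Y, hY, -, hmono⟩ := h (F ⟨x₁, y₁⟩).im
    have e₁ := (hY x₁ h₁ y₁).1 rfl
    have e₂ := (hY x₂ h₂ y₂).1 (by rw [heq])
    subst e₁ e₂
    have := hmono.injOn h₁ h₂ (congrArg Complex.re heq)
    subst this
    rfl
  · rintro _ ⟨⟨x₁, y₁⟩, h₁, rfl⟩ _ ⟨⟨x₂, y₂⟩, h₂, rfl⟩ him t ht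
    simp only [mem_ofPred_eq] at h₁ h₂
    obtain ⟨Y, hY, hcont, -⟩ := h (F ⟨x₁, y₁⟩).im
    have e₁ := (hY x₁ h₁ y₁).1 rfl
    have e₂ := (hY x₂ h₂ y₂).1 him.symm
    have hsub : uIcc x₁ x₂ ⊆ Ioi a := by
      intro x hx
      exact lt_of_lt_of_le (lt_min h₁ h₂) hx.1
    have hre : t.re ∈ uIcc (F ⟨x₁, Y x₁⟩).re (F ⟨x₂, Y x₂⟩).re := by
      have := mem_image_of_mem Complex.reLm.toAffineMap ht
      rw [image_segment] at this
      rw [← e₁, ← e₂, ← segment_eq_uIcc]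
      exact this
    have htim : t.im = (F ⟨x₁, y₁⟩).im := by
      have := mem_image_of_mem Complex.imLm.toAffineMap ht
      rw [image_segment] at this
      simpa [← him] using this
    obtain ⟨x, hx, hxt⟩ := intermediate_value_uIcc (hcont.mono hsub) hre
    refine ⟨⟨x, Y x⟩, hsub hx, Complex.ext hxt ?_⟩
    rw [htim]
    exact (hY x (hsub hx) _).2 rfl

/-! ### Taylor coefficients and convolution with `h₀` and `g₀`. -/

theorem norm_lt_one_of_mem_disk {z : ℂ} (hz : z ∈ disk) : ‖z‖ < 1 := mem_ball_zero_iff.1 hz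

theorem one_sub_ne_zero_of_mem_disk {z : ℂ} (hz : z ∈ disk) : 1 - z ≠ 0 := by
  intro h
  have := norm_lt_one_of_mem_disk hz
  rw [← sub_eq_zero.1 h] at this
  simp at this

theorem hasSum_coeff_mul_pow {F : ℂ → ℂ} (hF : DifferentiableOn ℂ F disk) {z : ℂ}
    (hz : z ∈ disk) : HasSum (fun n => coeff F n * z ^ n) (F z) := by
  convert! Complex.hasSum_taylorSeries_on_ball hF hz using 2 with n
  simp only [coeff, sub_zero, smul_eq_mul]
  ring

/-- Uniqueness of power series; the ball of radius `1/2` is enough, since convergence at `1/2`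
bounds the radius from below. -/
theorem coeff_eq_of_hasSum {F : ℂ → ℂ} {c : ℕ → ℂ}
    (h : ∀ z ∈ disk, HasSum (fun n => c n * z ^ n) (F z)) (n : ℕ) : coeff F n = c n := by
  have hhalf : ((1 / 2 : ℂ)) ∈ disk := by
    rw [mem_ball_zero_iff]
    norm_num
  have hball : HasFPowerSeriesOnBall F (FormalMultilinearSeries.ofScalars ℂ c) 0
      ((1 / 2 : NNReal) : ENNReal) := by
    refine ⟨?_, by norm_num, ?_⟩
    · refine FormalMultilinearSeries.le_radius_of_tendsto (l := 0) _ ?_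
      have := (h _ hhalf).summable.tendsto_atTop_zero.norm
      simpa [FormalMultilinearSeries.ofScalars_norm] using this
    · intro y hy
      rw [Metric.eball_coe, mem_ball_zero_iff] at hy
      have hy' : y ∈ disk := mem_ball_zero_iff.2 (hy.trans (by norm_num))
      simpa [FormalMultilinearSeries.ofScalars_apply_eq, mul_comm] using h y hy'
  have := hball.factorial_smul 1 n
  rw [iteratedDeriv_eq_iteratedFDeriv.symm] at this
  rw [coeff, ← this]
  simp [Nat.factorial_ne_zero]

theorem coeff_zero (F : ℂ → ℂ) : coeff F 0 = F 0 := by simp [coeff]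

theorem coeff_deriv (F : ℂ → ℂ) (n : ℕ) : coeff (deriv F) n = (n + 1) * coeff F (n + 1) := by
  rw [coeff, coeff, ← iteratedDeriv_succ', Nat.factorial_succ]
  have h1 : (n.factorial : ℂ) ≠ 0 := by exact_mod_cast n.factorial_ne_zero
  have h2 : (n + 1 : ℂ) ≠ 0 := by exact_mod_cast n.succ_ne_zero
  push_cast
  field_simp

theorem hasSum_nat_mul_coeff_mul_pow {F : ℂ → ℂ} (hF : AnalyticOnNhd ℂ F disk) {z : ℂ}
    (hz : z ∈ disk) : HasSum (fun n : ℕ => n * coeff F n * z ^ n) (z * deriv F z) := by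
  have h := (hasSum_coeff_mul_pow hF.deriv.differentiableOn hz).mul_left z
  rw [← hasSum_nat_add_iff' 1]
  simp only [Finset.range_one, Finset.sum_singleton, Nat.cast_zero, zero_mul, sub_zero]
  convert! h using 2 with n
  rw [coeff_deriv]
  push_cast
  ring

theorem hasSum_pow_succ_part {z : ℂ} (hz : z ∈ disk) :
    HasSum (fun n : ℕ => (if n = 0 then 0 else 1) * z ^ n) (z / (1 - z)) := by
  rw [← hasSum_nat_add_iff' 1]
  have h := (hasSum_geometric_of_norm_lt_one (norm_lt_one_of_mem_disk hz)).mul_left z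
  simp only [Finset.range_one, Finset.sum_singleton, if_true, zero_mul, sub_zero]
  rw [div_eq_mul_inv]
  convert! h using 2 with n
  simp [pow_succ']

/-- From `h₀ = (z / (1 - z) + z / (1 - z)²) / 2`. The constant term is an exception to the formula;
in the convolution it is harmless because `F 0 = 0`. -/
theorem coeff_h₀ (n : ℕ) : coeff h₀ n = if n = 0 then 0 else (1 + (n : ℂ)) / 2 := by
  refine coeff_eq_of_hasSum (c := fun n => if n = 0 then 0 else (1 + (n : ℂ)) / 2)
    (fun z hz => ?_) n
  have h1 := ((hasSum_pow_succ_part hz).add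
    (hasSum_coe_mul_geometric_of_norm_lt_one (norm_lt_one_of_mem_disk hz))).div_const 2
  have hne := one_sub_ne_zero_of_mem_disk hz
  have h2 : h₀ z = (z / (1 - z) + z / (1 - z) ^ 2) / 2 := by
    rw [h₀]
    field_simp
    ring
  rw [h2]
  convert! h1 using 2 with n
  split_ifs with h <;> simp [h]
  ring

theorem coeff_g₀ (n : ℕ) : coeff g₀ n = if n = 0 then 0 else (1 - (n : ℂ)) / 2 := by
  refine coeff_eq_of_hasSum (c := fun n => if n = 0 then 0 else (1 - (n : ℂ)) / 2)
    (fun z hz => ?_) n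
  have h1 := ((hasSum_pow_succ_part hz).sub
    (hasSum_coe_mul_geometric_of_norm_lt_one (norm_lt_one_of_mem_disk hz))).div_const 2
  have hne := one_sub_ne_zero_of_mem_disk hz
  have h2 : g₀ z = (z / (1 - z) - z / (1 - z) ^ 2) / 2 := by
    rw [g₀]
    field_simp
    ring
  rw [h2]
  convert! h1 using 2 with n
  split_ifs with h <;> simp [h]
  ring

theorem hadamard_h₀ {F : ℂ → ℂ} (hF : AnalyticOnNhd ℂ F disk) (h0 : F 0 = 0) {z : ℂ}
    (hz : z ∈ disk) : hadamard h₀ F z = (F z + z * deriv F z) / 2 := by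
  refine HasSum.tsum_eq ?_
  convert! ((hasSum_coeff_mul_pow hF.differentiableOn hz).add
    (hasSum_nat_mul_coeff_mul_pow hF hz)).div_const 2 using 2 with n
  rw [coeff_h₀]
  split_ifs with h
  · simp [h, coeff_zero, h0]
  · ring

theorem hadamard_g₀ {F : ℂ → ℂ} (hF : AnalyticOnNhd ℂ F disk) (h0 : F 0 = 0) {z : ℂ}
    (hz : z ∈ disk) : hadamard g₀ F z = (F z - z * deriv F z) / 2 := by
  refine HasSum.tsum_eq ?_
  convert! ((hasSum_coeff_mul_pow hF.differentiableOn hz).sub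
    (hasSum_nat_mul_coeff_mul_pow hF hz)).div_const 2 using 2 with n
  rw [coeff_g₀]
  split_ifs with h
  · simp [h, coeff_zero, h0]
  · ring

/-! ### Wirtinger calculus for `H + conj G`. -/

/-- The real-linear map `v ↦ a v + conj (b v)`. -/
noncomputable def wirtingerCLM (a b : ℂ) : ℂ →L[ℝ] ℂ :=
  (ContinuousLinearMap.mul ℝ ℂ a) + Complex.conjCLE.toContinuousLinearMap ∘L
    (ContinuousLinearMap.mul ℝ ℂ b)

@[simp]
theorem wirtingerCLM_apply (a b v : ℂ) : wirtingerCLM a b v = a * v + conj (b * v) := rfl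

theorem hasStrictFDerivAt_add_conj {H G : ℂ → ℂ} {a b z : ℂ} (hH : HasStrictDerivAt H a z)
    (hG : HasStrictDerivAt G b z) :
    HasStrictFDerivAt (fun z => H z + conj (G z)) (wirtingerCLM a b) z := by
  have h1 := hH.complexToReal_fderiv
  have h2 := Complex.conjCLE.toContinuousLinearMap.hasStrictFDerivAt.comp z
    hG.complexToReal_fderiv
  refine (h1.add h2).congr_fderiv ?_
  ext v
  simp

theorem det_wirtingerCLM (a b : ℂ) :
    (wirtingerCLM a b).det = Complex.normSq a - Complex.normSq b := by
  rw [ContinuousLinearMap.det, ← LinearMap.det_toMatrix Complex.basisOneI, Matrix.det_fin_two]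
  simp [LinearMap.toMatrix_apply, Complex.normSq_apply]
  ring

theorem dz_eq_of_hasFDerivAt {f : ℂ → ℂ} {a b z : ℂ}
    (h : HasFDerivAt f (wirtingerCLM a b) z) : dz f z = a := by
  rw [dz, h.fderiv]
  simp only [wirtingerCLM_apply, map_mul, Complex.conj_I, map_one]
  linear_combination (-a / 2 + conj b / 2) * Complex.I_sq

theorem dzbar_eq_of_hasFDerivAt {f : ℂ → ℂ} {a b z : ℂ}
    (h : HasFDerivAt f (wirtingerCLM a b) z) : dzbar f z = conj b := by
  rw [dzbar, h.fderiv]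
  simp only [wirtingerCLM_apply, map_mul, Complex.conj_I, map_one]
  linear_combination (a / 2 - conj b / 2) * Complex.I_sq

/-! ### Univalence criteria on the half-plane and the disk. -/

/-- A harmonic map `A + conj B` on a vertical half-plane with positive Jacobian, whose imaginary
part increases along vertical lines at a rate bounded below, is univalent with image convex in the
real direction. -/
theorem injOn_and_convexInRealDirection_halfPlane {A B A' B' : ℂ → ℂ} {a : ℝ}
    (hA : ∀ w : ℂ, a < w.re → HasStrictDerivAt A (A' w) w)
    (hB : ∀ w : ℂ, a < w.re → HasStrictDerivAt B (B' w) w)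
    (hlt : ∀ w : ℂ, a < w.re → ‖B' w‖ < ‖A' w‖)
    (hre : ∀ w : ℂ, a < w.re → w.re - a ≤ (A' w - B' w).re) :
    InjOn (fun w => A w + conj (B w)) {w : ℂ | a < w.re} ∧
      ConvexInRealDirection ((fun w => A w + conj (B w)) '' {w : ℂ | a < w.re}) := by
  let e : ℝ × ℝ →L[ℝ] ℂ := Complex.equivRealProdCLM.symm.toContinuousLinearMap
  have he : ∀ x y : ℝ, e (x, y) = ⟨x, y⟩ := fun x y => by apply Complex.ext <;> simp [e]
  have hF : ∀ p : ℝ × ℝ, a < p.1 → HasStrictFDerivAt (fun p => A (e p) + conj (B (e p)))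
      (wirtingerCLM (A' (e p)) (B' (e p)) ∘L e) p := by
    intro p hp
    have hp' : a < (e p).re := by
      rw [← Prod.mk.eta (p := p), he]
      exact hp
    exact (hasStrictFDerivAt_add_conj (hA _ hp') (hB _ hp')).comp p e.hasStrictFDerivAt
  have hre' : ∀ p : ℝ × ℝ, a < p.1 → p.1 - a ≤ (A' (e p) - B' (e p)).re := by
    rintro ⟨x, y⟩ hp
    rw [he]
    exact hre ⟨x, y⟩ hp
  let U' : ℝ × ℝ → ℝ × ℝ →L[ℝ] ℝ := fun p =>
    Complex.reCLM ∘L (wirtingerCLM (A' (e p)) (B' (e p)) ∘L e)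
  let V' : ℝ × ℝ → ℝ × ℝ →L[ℝ] ℝ := fun p =>
    Complex.imCLM ∘L (wirtingerCLM (A' (e p)) (B' (e p)) ∘L e)
  have hU : ∀ p : ℝ × ℝ, a < p.1 →
      HasStrictFDerivAt (fun p => (A (e p) + conj (B (e p))).re) (U' p) p := fun p hp =>
    Complex.reCLM.hasStrictFDerivAt.comp p (hF p hp)
  have hV : ∀ p : ℝ × ℝ, a < p.1 →
      HasStrictFDerivAt (fun p => (A (e p) + conj (B (e p))).im) (V' p) p := fun p hp =>
    Complex.imCLM.hasStrictFDerivAt.comp p (hF p hp)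
  have hV01 : ∀ p, V' p (0, 1) = (A' (e p) - B' (e p)).re := fun p => by simp [V', he]; ring
  have hV10 : ∀ p, V' p (1, 0) = (A' (e p) - B' (e p)).im := fun p => by simp [V', he]; ring
  have hU01 : ∀ p, U' p (0, 1) = -(A' (e p) + B' (e p)).im := fun p => by simp [U', he]; ring
  have hU10 : ∀ p, U' p (1, 0) = (A' (e p) + B' (e p)).re := fun p => by simp [U', he]
  refine injOn_and_convexInRealDirection_of_level_curves fun c => ?_
  have := exists_level_curve hU hV ?_ ?_ ?_ c
  · simpa only [he] using this
  · intro p hp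
    rw [hV01]
    linarith [hre' p hp]
  · intro p hp
    rw [hV01, hV10, hU01, hU10]
    have hp' : a < (e p).re := by
      rw [← Prod.mk.eta (p := p), he]
      exact hp
    have h1 := pow_lt_pow_left₀ (hlt _ hp') (norm_nonneg _) two_ne_zero
    rw [← Complex.normSq_eq_norm_sq, ← Complex.normSq_eq_norm_sq, Complex.normSq_apply,
      Complex.normSq_apply] at h1
    simp only [Complex.add_re, Complex.add_im, Complex.sub_re, Complex.sub_im]
    linarith
  · intro x hx c
    set v : ℝ → ℝ := fun y => (A (e (x, y)) + conj (B (e (x, y)))).im with hv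
    have hline : ∀ y, HasDerivAt v (V' (x, y) (0, 1)) y := by
      intro y
      have h1 : HasDerivAt (fun y : ℝ => (x, y)) ((0 : ℝ), (1 : ℝ)) y :=
        (hasDerivAt_const y x).prodMk (hasDerivAt_id y)
      exact (hV (x, y) hx).hasFDerivAt.comp_hasDerivAt y h1
    have hdiff : Differentiable ℝ v := fun y => (hline y).differentiableAt
    have hbound : ∀ y, x - a ≤ deriv v y := by
      intro y
      rw [(hline y).deriv, hV01]
      exact hre' (x, y) hx
    have hgrow := mul_sub_le_image_sub_of_le_deriv hdiff hbound
    have hδ : 0 < x - a := sub_pos.2 hx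
    -- With slope at least `x - a`, moving by `|c - v 0| / (x - a)` either way from `0` changes `v`
    -- by at least `|c - v 0|`, enough to pass `c`.
    refine mem_range_of_exists_le_of_exists_ge hdiff.continuous
      ⟨-(|c - v 0| / (x - a)), ?_⟩ ⟨|c - v 0| / (x - a), ?_⟩
    · have h1 := hgrow (x := -(|c - v 0| / (x - a))) (y := 0)
        (neg_nonpos.2 (by positivity))
      rw [zero_sub, neg_neg, mul_div_cancel₀ _ hδ.ne'] at h1
      linarith [neg_abs_le (c - v 0)]
    · have h1 := hgrow (x := 0) (y := |c - v 0| / (x - a)) (by positivity)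
      rw [sub_zero, mul_div_cancel₀ _ hδ.ne'] at h1
      linarith [le_abs_self (c - v 0)]

theorem one_add_ne_zero_of_halfPlane {w : ℂ} (hw : -(1 / 2) < w.re) : 1 + w ≠ 0 := by
  intro h
  have := congrArg Complex.re h
  simp only [Complex.add_re, Complex.one_re, Complex.zero_re] at this
  linarith

/-- `|1 + w|² - |w|² = 1 + 2 Re w`; the inverse map is `z / (1 - z)`. -/
theorem image_halfPlane_div_one_add :
    (fun w : ℂ => w / (1 + w)) '' {w : ℂ | -(1 / 2) < w.re} = disk := by
  have key : ∀ w : ℂ, Complex.normSq (1 + w) - Complex.normSq w = 1 + 2 * w.re := fun w => by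
    simp only [Complex.normSq_apply, Complex.add_re, Complex.add_im, Complex.one_re,
      Complex.one_im]
    ring
  have hlt : ∀ w : ℂ, 1 + w ≠ 0 → (w / (1 + w) ∈ disk ↔ -(1 / 2) < w.re) := by
    intro w hw
    rw [mem_ball_zero_iff, norm_div, div_lt_one (norm_pos_iff.2 hw),
      ← sq_lt_sq₀ (norm_nonneg _) (norm_nonneg _), ← Complex.normSq_eq_norm_sq,
      ← Complex.normSq_eq_norm_sq, ← sub_pos, key]
    constructor <;> intro h <;> linarith
  ext z
  constructor
  · rintro ⟨w, hw, rfl⟩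
    exact (hlt w (one_add_ne_zero_of_halfPlane hw)).2 hw
  · intro hz
    have h1 := one_sub_ne_zero_of_mem_disk hz
    have h2 : 1 + z / (1 - z) = 1 / (1 - z) := by
      field_simp
      ring
    have h3 : z / (1 - z) / (1 + z / (1 - z)) = z := by
      rw [h2]
      field_simp
    have h4 : 1 + z / (1 - z) ≠ 0 := by
      rw [h2]
      exact one_div_ne_zero h1
    exact ⟨z / (1 - z), (hlt _ h4).1 (by rwa [h3]), h3⟩

/-- A harmonic map `H + conj G` of the disk with positive Jacobian for which
`Re ((1 - z)² (H' - G'))` is at least half of `Re ((1 + z) / (1 - z))` is univalent with image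
convex in the real direction. -/
theorem injOn_and_convexInRealDirection_disk {H G H' G' : ℂ → ℂ}
    (hH : ∀ z ∈ disk, HasStrictDerivAt H (H' z) z)
    (hG : ∀ z ∈ disk, HasStrictDerivAt G (G' z) z)
    (hlt : ∀ z ∈ disk, ‖G' z‖ < ‖H' z‖)
    (hre : ∀ z ∈ disk, ((1 + z) / (1 - z)).re / 2 ≤ ((1 - z) ^ 2 * (H' z - G' z)).re) :
    InjOn (fun z => H z + conj (G z)) disk ∧
      ConvexInRealDirection ((fun z => H z + conj (G z)) '' disk) := by
  set P : Set ℂ := {w : ℂ | -(1 / 2) < w.re} with hP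
  set m : ℂ → ℂ := fun w => w / (1 + w) with hm
  have hmem : ∀ w : ℂ, -(1 / 2) < w.re → m w ∈ disk := fun w hw => by
    rw [← image_halfPlane_div_one_add]
    exact mem_image_of_mem _ hw
  have hsub : ∀ w : ℂ, -(1 / 2) < w.re → 1 - m w = (1 + w)⁻¹ := fun w hw => by
    have := one_add_ne_zero_of_halfPlane hw
    simp only [hm]
    field_simp
    ring
  have hdm : ∀ w : ℂ, -(1 / 2) < w.re → HasStrictDerivAt m ((1 - m w) ^ 2) w := fun w hw => by
    have h0 := one_add_ne_zero_of_halfPlane hw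
    have := (hasStrictDerivAt_id w).div ((hasStrictDerivAt_id w).const_add 1) h0
    rw [hsub w hw]
    convert! this using 1
    simp only [id]
    field_simp
    ring
  have hmain := injOn_and_convexInRealDirection_halfPlane (a := -(1 / 2))
    (A := fun w => H (m w)) (B := fun w => G (m w))
    (A' := fun w => H' (m w) * (1 - m w) ^ 2) (B' := fun w => G' (m w) * (1 - m w) ^ 2)
    (fun w hw => (hH _ (hmem w hw)).comp w (hdm w hw))
    (fun w hw => (hG _ (hmem w hw)).comp w (hdm w hw)) ?_ ?_
  · have himg : (fun z => H z + conj (G z)) '' disk =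
        (fun w => H (m w) + conj (G (m w))) '' P := by
      rw [← image_halfPlane_div_one_add, image_image]
    refine ⟨?_, himg ▸ hmain.2⟩
    rw [← image_halfPlane_div_one_add]
    rintro _ ⟨w₁, h₁, rfl⟩ _ ⟨w₂, h₂, rfl⟩ heq
    rw [hmain.1 h₁ h₂ heq]
  · intro w hw
    rw [norm_mul, norm_mul]
    refine mul_lt_mul_of_pos_right (hlt _ (hmem w hw)) (norm_pos_iff.2 (pow_ne_zero 2 ?_))
    exact one_sub_ne_zero_of_mem_disk (hmem w hw)
  · intro w hw
    have h1 := hre _ (hmem w hw)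
    have h0 := one_add_ne_zero_of_halfPlane hw
    -- This turns the disk hypothesis into the bound `Re w + 1/2`, the distance to the boundary
    -- line.
    have h2 : (1 + m w) / (1 - m w) = 1 + 2 * w := by
      rw [hsub w hw]
      simp only [hm]
      field_simp
      ring
    rw [h2] at h1
    rw [← sub_mul, mul_comm (H' _ - G' _)]
    simp only [Complex.add_re, Complex.one_re, Complex.mul_re, Complex.re_ofNat,
      Complex.im_ofNat, zero_mul, sub_zero] at h1 ⊢
    linarith

/-! ### Estimates from the dilatation. -/

/-- For `|e| = 1` the left polynomial is `e` times the reciprocal `z² conj (q (1 / conj z))` of the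
right one, `q`. So the difference of squared moduli has the factor `1 - |z|²`; the cofactor is at
least `3 (1 - |z|)²` because `|2e - 1| ≤ 3`. -/
theorem norm_lt_norm_of_self_reciprocal {e z : ℂ} (he : ‖e‖ = 1) (hz : ‖z‖ < 1) :
    ‖1 + z + 2 * e * z ^ 2‖ < ‖2 + e * z + e * z ^ 2‖ := by
  rw [← sq_lt_sq₀ (norm_nonneg _) (norm_nonneg _), ← sub_pos]
  have h1 : ‖2 + e * z + e * z ^ 2‖ ^ 2 - ‖1 + z + 2 * e * z ^ 2‖ ^ 2 =
      (1 - ‖z‖ ^ 2) * (3 * (1 + ‖z‖ ^ 2) + 2 * ((2 * e - 1) * z).re) := by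
    have he2 : Complex.normSq e = 1 := by rw [Complex.normSq_eq_norm_sq, he]; norm_num
    rw [Complex.normSq_apply] at he2
    simp only [← Complex.normSq_eq_norm_sq]
    simp only [Complex.normSq_apply, pow_two, Complex.add_re,
      Complex.add_im, Complex.mul_re, Complex.mul_im, Complex.sub_re, Complex.sub_im,
      Complex.one_re, Complex.one_im, Complex.re_ofNat, Complex.im_ofNat]
    linear_combination ((z.re + (z.re ^ 2 - z.im ^ 2)) ^ 2 + (z.im + 2 * z.re * z.im) ^ 2 -
      4 * (z.re ^ 2 + z.im ^ 2) ^ 2) * he2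
  have h2 : -(3 * ‖z‖) ≤ ((2 * e - 1) * z).re := by
    refine (neg_le_neg ?_).trans (abs_le.1 (Complex.abs_re_le_norm _)).1
    rw [norm_mul]
    refine mul_le_mul_of_nonneg_right ((norm_sub_le _ _).trans ?_) (norm_nonneg _)
    rw [norm_mul, he]
    norm_num
  rw [h1]
  have h3 : 0 < 1 - ‖z‖ ^ 2 := by nlinarith [norm_nonneg z]
  refine mul_pos h3 ?_
  nlinarith [sq_pos_of_pos (sub_pos.2 hz)]

/-- The derivatives of `(h + z h') / 2` and `(g - z g') / 2`, up to the common factor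
`2 (1 + ω)² (1 - z)³`, compared for the dilatations `e z` and `e z²`. -/
theorem norm_lt_norm_of_dilatation {e z ω ω' : ℂ} (he : ‖e‖ = 1) (hz : ‖z‖ < 1)
    (h : ω = e * z ∧ ω' = e ∨ ω = e * z ^ 2 ∧ ω' = 2 * e * z) :
    ‖z * (ω' * (1 - z) + 2 * ω * (1 + ω))‖ < ‖2 * (1 + ω) - z * ω' * (1 - z)‖ := by
  rcases h with ⟨rfl, rfl⟩ | ⟨rfl, rfl⟩
  · have h1 : z * (ω' * (1 - z) + 2 * (ω' * z) * (1 + ω' * z)) =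
        (ω' * z) * (1 + z + 2 * ω' * z ^ 2) := by ring
    have h2 : 2 * (1 + ω' * z) - z * ω' * (1 - z) = 2 + ω' * z + ω' * z ^ 2 := by ring
    rw [h1, h2, norm_mul, norm_mul, he, one_mul]
    exact (mul_le_of_le_one_left (norm_nonneg _) hz.le).trans_lt
      (norm_lt_norm_of_self_reciprocal he hz)
  -- For `ω = e z²` the two sides share the factor `2 (1 + e z³)`, and only `|e z²| < 1` is left to
  -- use.
  · have h1 : z * (2 * e * z * (1 - z) + 2 * (e * z ^ 2) * (1 + e * z ^ 2)) =
        e * z ^ 2 * (2 * (1 + e * z ^ 3)) := by ring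
    have h2 : 2 * (1 + e * z ^ 2) - z * (2 * e * z) * (1 - z) = 2 * (1 + e * z ^ 3) := by ring
    rw [h1, h2, norm_mul, norm_mul, norm_pow, he, one_mul]
    refine mul_lt_of_lt_one_left (norm_pos_iff.2 (mul_ne_zero two_ne_zero fun h0 => ?_))
      (pow_lt_one₀ (norm_nonneg _) hz two_ne_zero)
    have h3 : ‖e * z ^ 3‖ = 1 := by
      rw [eq_neg_of_add_eq_zero_right h0, norm_neg, norm_one]
    rw [norm_mul, he, one_mul, norm_pow] at h3
    exact (pow_lt_one₀ (norm_nonneg _) hz three_ne_zero).ne h3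

theorem one_add_ne_zero_of_norm_lt_one {ω : ℂ} (h : ‖ω‖ < 1) : 1 + ω ≠ 0 := by
  intro h0
  rw [eq_neg_of_add_eq_zero_right h0, norm_neg, norm_one] at h
  exact lt_irrefl _ h

theorem re_one_sub_div_one_add_nonneg {ω : ℂ} (h : ‖ω‖ < 1) : 0 ≤ ((1 - ω) / (1 + ω)).re := by
  have h2 : ‖ω‖ ^ 2 < 1 := pow_lt_one₀ (norm_nonneg _) h two_ne_zero
  rw [← Complex.normSq_eq_norm_sq, Complex.normSq_apply] at h2
  rw [Complex.div_re, ← add_div]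
  refine div_nonneg ?_ (Complex.normSq_nonneg _)
  simp only [Complex.sub_re, Complex.add_re, Complex.sub_im, Complex.add_im, Complex.one_re,
    Complex.one_im]
  nlinarith

/-! ### Derivatives of the convolution and verification of the criterion. -/

/-- Second derivatives of a pair `h, g` whose derivatives are determined by
`h + g = z / (1 - z)` and the dilatation `ω`. -/
theorem deriv_deriv_of_dilatation {h g ω : ℂ → ℂ} {z ω' : ℂ} (hz : z ∈ disk)
    (hh : ∀ z ∈ disk, deriv h z = 1 / ((1 + ω z) * (1 - z) ^ 2))
    (hg : ∀ z ∈ disk, deriv g z = ω z / ((1 + ω z) * (1 - z) ^ 2))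
    (hω : HasDerivAt ω ω' z) (h0 : 1 + ω z ≠ 0) :
    deriv (deriv h) z =
        (2 * (1 + ω z) - ω' * (1 - z)) / ((1 + ω z) ^ 2 * (1 - z) ^ 3) ∧
      deriv (deriv g) z =
        (ω' * (1 - z) + 2 * ω z * (1 + ω z)) / ((1 + ω z) ^ 2 * (1 - z) ^ 3) := by
  have h1 := one_sub_ne_zero_of_mem_disk hz
  have hnhds : disk ∈ 𝓝 z := Metric.isOpen_ball.mem_nhds hz
  have hden : HasDerivAt (fun z => (1 + ω z) * (1 - z) ^ 2)
      (ω' * (1 - z) ^ 2 + (1 + ω z) * (2 * (1 - z) * -1)) z := by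
    have h2 := (((hasDerivAt_id z).const_sub 1).pow 2)
    convert! (hω.const_add 1).mul h2 using 1
    simp
  have hne : (1 + ω z) * (1 - z) ^ 2 ≠ 0 := mul_ne_zero h0 (pow_ne_zero 2 h1)
  constructor
  · have e1 : deriv h =ᶠ[𝓝 z] fun z => 1 / ((1 + ω z) * (1 - z) ^ 2) :=
      Filter.eventually_of_mem hnhds hh
    rw [e1.deriv_eq, ((hasDerivAt_const z (1 : ℂ)).fun_div hden hne).deriv]
    field_simp
    ring
  · have e1 : deriv g =ᶠ[𝓝 z] fun z => ω z / ((1 + ω z) * (1 - z) ^ 2) :=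
      Filter.eventually_of_mem hnhds hg
    rw [e1.deriv_eq, (hω.fun_div hden hne).deriv]
    field_simp
    ring

theorem IsDecomposition.hasFDerivAt {f h g : ℂ → ℂ} (hd : IsDecomposition f h g) {z : ℂ}
    (hz : z ∈ disk) : HasFDerivAt f (wirtingerCLM (deriv h z) (deriv g z)) z := by
  have h1 := (hasStrictFDerivAt_add_conj (hd.analytic_h z hz).hasStrictDerivAt
    (hd.analytic_g z hz).hasStrictDerivAt).hasFDerivAt
  exact h1.congr_of_eventuallyEq
    (Filter.eventually_of_mem (Metric.isOpen_ball.mem_nhds hz) hd.eq)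

theorem IsDecomposition.harmonicOnNhd {f h g : ℂ → ℂ} (hd : IsDecomposition f h g) :
    InnerProductSpace.HarmonicOnNhd f disk := by
  intro z hz
  have h1 := (hd.analytic_h z hz).harmonicAt.add (hd.analytic_g z hz).harmonicAt_conj
  refine (InnerProductSpace.harmonicAt_congr_nhds ?_).1 h1
  exact Filter.eventually_of_mem (Metric.isOpen_ball.mem_nhds hz) fun w hw => (hd.eq w hw).symm

/-- The decomposition of the convolution with `f₀`. -/
theorem isDecomposition_harmonicConv {h g : ℂ → ℂ} (hh : AnalyticOnNhd ℂ h disk)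
    (hg : AnalyticOnNhd ℂ g disk) (h0 : h 0 = 0) (g0 : g 0 = 0) :
    IsDecomposition (harmonicConv h₀ g₀ h g) (fun z => (h z + z * deriv h z) / 2)
      (fun z => (g z - z * deriv g z) / 2) where
  analytic_h z hz := ((hh z hz).add (analyticAt_id.mul (hh z hz).deriv)).div_const
  analytic_g z hz := ((hg z hz).sub (analyticAt_id.mul (hg z hz).deriv)).div_const
  h_zero := by simp [h0]
  g_zero := by simp [g0]
  eq z hz := by rw [harmonicConv, hadamard_h₀ hh h0 hz, hadamard_g₀ hg g0 hz]

/-- A map `H + conj G` satisfying the normalization and the two derivative estimates lies in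
`S_H^O` and is convex in the real direction. -/
theorem IsDecomposition.isSHO_and_convexInRealDirection {F H G : ℂ → ℂ}
    (hd : IsDecomposition F H G) (hH : deriv H 0 = 1) (hG : deriv G 0 = 0)
    (hlt : ∀ z ∈ disk, ‖deriv G z‖ < ‖deriv H z‖)
    (hre : ∀ z ∈ disk,
      ((1 + z) / (1 - z)).re / 2 ≤ ((1 - z) ^ 2 * (deriv H z - deriv G z)).re) :
    IsSHO F ∧ ConvexInRealDirection (F '' disk) := by
  have hzero : (0 : ℂ) ∈ disk := Metric.mem_ball_self one_pos
  have hmain := injOn_and_convexInRealDirection_disk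
    (fun z hz => (hd.analytic_h z hz).hasStrictDerivAt)
    (fun z hz => (hd.analytic_g z hz).hasStrictDerivAt) hlt hre
  have heq : EqOn F (fun z => H z + conj (G z)) disk := hd.eq
  refine ⟨⟨hd.harmonicOnNhd, fun z hz => ?_, heq.injOn_iff.2 hmain.1, ?_, ?_, ?_⟩, ?_⟩
  · rw [(hd.hasFDerivAt hz).fderiv, det_wirtingerCLM, Complex.normSq_eq_norm_sq,
      Complex.normSq_eq_norm_sq, sub_pos]
    exact pow_lt_pow_left₀ (hlt z hz) (norm_nonneg _) two_ne_zero
  · rw [hd.eq 0 hzero, hd.h_zero, hd.g_zero, map_zero, add_zero]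
  · rw [dz_eq_of_hasFDerivAt (hd.hasFDerivAt hzero), hH]
  · rw [dzbar_eq_of_hasFDerivAt (hd.hasFDerivAt hzero), hG, map_zero]
  · rw [heq.image_eq]
    exact hmain.2

/-- The derivatives of the two parts of a half-plane mapping in terms of its dilatation. -/
theorem deriv_eq_of_dilatation {h g ω : ℂ → ℂ} (hh : AnalyticOnNhd ℂ h disk)
    (hg : AnalyticOnNhd ℂ g disk) (hsum : ∀ z ∈ disk, h z + g z = z / (1 - z))
    (hω : ∀ z ∈ disk, deriv g z = ω z * deriv h z) (hne : ∀ z ∈ disk, 1 + ω z ≠ 0) :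
    (∀ z ∈ disk, deriv h z = 1 / ((1 + ω z) * (1 - z) ^ 2)) ∧
      ∀ z ∈ disk, deriv g z = ω z / ((1 + ω z) * (1 - z) ^ 2) := by
  have key : ∀ z ∈ disk, deriv h z = 1 / ((1 + ω z) * (1 - z) ^ 2) := by
    intro z hz
    have h1 := one_sub_ne_zero_of_mem_disk hz
    have h2 : HasDerivAt (fun z : ℂ => z / (1 - z)) (1 / (1 - z) ^ 2) z := by
      convert! (hasDerivAt_id z).div ((hasDerivAt_id z).const_sub 1) h1 using 1
      simp
    have h3 : HasDerivAt (fun z => h z + g z) (deriv h z + deriv g z) z :=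
      (hh z hz).differentiableAt.hasDerivAt.add (hg z hz).differentiableAt.hasDerivAt
    have h4 := (h3.congr_of_eventuallyEq
      (Filter.eventually_of_mem (Metric.isOpen_ball.mem_nhds hz)
        fun w hw => (hsum w hw).symm)).unique h2
    rw [hω z hz] at h4
    have h5 := hne z hz
    rw [mul_comm, ← div_div, ← h4]
    field_simp
  refine ⟨key, fun z hz => ?_⟩
  rw [hω z hz, key z hz, mul_one_div]

theorem deriv_convolution_parts {h g : ℂ → ℂ} {z : ℂ} (hh : AnalyticAt ℂ h z)
    (hg : AnalyticAt ℂ g z) :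
    deriv (fun z => (h z + z * deriv h z) / 2) z = deriv h z + z * deriv (deriv h) z / 2 ∧
      deriv (fun z => (g z - z * deriv g z) / 2) z = -(z * deriv (deriv g) z / 2) := by
  have h1 := hh.differentiableAt.hasDerivAt
  have h2 := hh.deriv.differentiableAt.hasDerivAt
  have g1 := hg.differentiableAt.hasDerivAt
  have g2 := hg.deriv.differentiableAt.hasDerivAt
  constructor
  · refine HasDerivAt.deriv ?_
    convert! (h1.add ((hasDerivAt_id z).mul h2)).div_const 2 using 1
    simp only [id]
    ring
  · refine HasDerivAt.deriv ?_
    convert! (g1.sub ((hasDerivAt_id z).mul g2)).div_const 2 using 1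
    simp only [id]
    ring

end HarmonicMapping

theorem theorem3 (f h g : ℂ → ℂ) (n : ℕ) (θ : ℝ)
    (hf : HarmonicMapping.IsKHO f)
    (hdec : HarmonicMapping.IsDecomposition f h g)
    (hsum : ∀ z ∈ HarmonicMapping.disk, h z + g z = z / (1 - z))
    (hω : ∀ z ∈ HarmonicMapping.disk,
      HarmonicMapping.dilatation h g z = Complex.exp (Complex.I * (θ : ℂ)) * z ^ n)
    (hn : n = 1 ∨ n = 2) :
    HarmonicMapping.IsSHO
        (HarmonicMapping.harmonicConv HarmonicMapping.h₀ HarmonicMapping.g₀ h g) ∧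
      HarmonicMapping.ConvexInRealDirection
        (HarmonicMapping.harmonicConv HarmonicMapping.h₀ HarmonicMapping.g₀ h g ''
          HarmonicMapping.disk) := by
  open HarmonicMapping in
  set e : ℂ := Complex.exp (Complex.I * (θ : ℂ)) with he_def
  have he : ‖e‖ = 1 := by rw [he_def, mul_comm, Complex.norm_exp_ofReal_mul_I]
  have hzero : (0 : ℂ) ∈ disk := Metric.mem_ball_self one_pos
  have hn0 : n ≠ 0 := by omega
  have hh0 : deriv h 0 = 1 := by
    rw [← dz_eq_of_hasFDerivAt (hdec.hasFDerivAt hzero), hf.dz_zero]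
  have hωlt : ∀ z ∈ disk, ‖e * z ^ n‖ < 1 := fun z hz => by
    rw [norm_mul, he, one_mul, norm_pow]
    exact pow_lt_one₀ (norm_nonneg _) (norm_lt_one_of_mem_disk hz) hn0
  have hne : ∀ z ∈ disk, 1 + e * z ^ n ≠ 0 := fun z hz =>
    one_add_ne_zero_of_norm_lt_one (hωlt z hz)
  have hmul : ∀ z ∈ disk, deriv g z = e * z ^ n * deriv h z := by
    intro z hz
    -- Division by zero yields `0`, so a zero of `h'` would make the dilatation vanish; `e z ^ n`
    -- vanishes only at the origin, where `h' = 1`.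
    have hd : deriv h z ≠ 0 := by
      intro hd
      rcases eq_or_ne z 0 with rfl | hz0
      · simp [hh0] at hd
      · have h1 := hω z hz
        rw [dilatation, hd, div_zero] at h1
        exact mul_ne_zero (Complex.exp_ne_zero _) (pow_ne_zero n hz0) h1.symm
    rw [← hω z hz, dilatation, div_mul_cancel₀ _ hd]
  obtain ⟨hh, hg⟩ := deriv_eq_of_dilatation hdec.analytic_h hdec.analytic_g hsum hmul hne
  have hcase : ∀ z, ∃ ω', HasDerivAt (fun z => e * z ^ n) ω' z ∧
      (e * z ^ n = e * z ∧ ω' = e ∨ e * z ^ n = e * z ^ 2 ∧ ω' = 2 * e * z) := by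
    intro z
    refine ⟨_, (hasDerivAt_pow n z).const_mul e, ?_⟩
    rcases hn with rfl | rfl
    · left
      simp
    · right
      refine ⟨rfl, ?_⟩
      simp
      ring
  have hparts : ∀ z ∈ disk, ∃ ω',
      (e * z ^ n = e * z ∧ ω' = e ∨ e * z ^ n = e * z ^ 2 ∧ ω' = 2 * e * z) ∧
      deriv (fun z => (h z + z * deriv h z) / 2) z =
        (2 * (1 + e * z ^ n) - z * ω' * (1 - z)) /
          (2 * (1 + e * z ^ n) ^ 2 * (1 - z) ^ 3) ∧
      deriv (fun z => (g z - z * deriv g z) / 2) z =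
        -(z * (ω' * (1 - z) + 2 * (e * z ^ n) * (1 + e * z ^ n))) /
          (2 * (1 + e * z ^ n) ^ 2 * (1 - z) ^ 3) := by
    intro z hz
    obtain ⟨ω', hω', hc⟩ := hcase z
    obtain ⟨h2, g2⟩ := deriv_deriv_of_dilatation hz hh hg hω' (hne z hz)
    obtain ⟨h3, g3⟩ := deriv_convolution_parts (hdec.analytic_h z hz) (hdec.analytic_g z hz)
    have h1 := one_sub_ne_zero_of_mem_disk hz
    have h4 := hne z hz
    refine ⟨ω', hc, ?_, ?_⟩
    · rw [h3, h2, hh z hz]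
      generalize e * z ^ n = ω at *
      field_simp
      ring
    · rw [g3, g2]
      generalize e * z ^ n = ω at *
      field_simp
  refine (isDecomposition_harmonicConv hdec.analytic_h hdec.analytic_g hdec.h_zero
    hdec.g_zero).isSHO_and_convexInRealDirection ?_ ?_ ?_ ?_
  · rw [(deriv_convolution_parts (hdec.analytic_h 0 hzero) (hdec.analytic_g 0 hzero)).1, hh0]
    simp
  · rw [(deriv_convolution_parts (hdec.analytic_h 0 hzero) (hdec.analytic_g 0 hzero)).2]
    simp
  · intro z hz
    obtain ⟨ω', hc, h1, h2⟩ := hparts z hz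
    rw [h1, h2, norm_div, norm_div, norm_neg]
    refine div_lt_div_of_pos_right
      (norm_lt_norm_of_dilatation he (norm_lt_one_of_mem_disk hz) hc) (norm_pos_iff.2 ?_)
    exact mul_ne_zero (mul_ne_zero two_ne_zero (pow_ne_zero 2 (hne z hz)))
      (pow_ne_zero 3 (one_sub_ne_zero_of_mem_disk hz))
  · intro z hz
    obtain ⟨ω', -, h1, h2⟩ := hparts z hz
    have h3 := one_sub_ne_zero_of_mem_disk hz
    have h4 := hne z hz
    have h5 := re_one_sub_div_one_add_nonneg (hωlt z hz)
    -- Both sides equal `(1 + z ω) / ((1 + ω) (1 - z))` with `ω = e z ^ n`.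
    have h6 : (1 - z) ^ 2 * (deriv (fun z => (h z + z * deriv h z) / 2) z -
        deriv (fun z => (g z - z * deriv g z) / 2) z) =
        ((1 - e * z ^ n) / (1 + e * z ^ n) + (1 + z) / (1 - z)) / 2 := by
      rw [h1, h2]
      generalize e * z ^ n = ω at *
      field_simp
      ring
    rw [h6, Complex.div_ofNat_re, Complex.add_re]
    linarith
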